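/- Let $\Omega\subset\mathbb R^2$ be an open set divided into finitely many non-overlapping polygonal subdomains $\Omega_1,\dots,\Omega_n$: the $\Omega_i\subseteq\Omega$ are pairwise disjoint bounded open sets whose boundaries $\Gamma_i=\partial\Omega_i$ are covered by finitely many line segments, and $\overline\Omega=\bigcup_i\overline{\Omega_i}$. Let $K\in L^\infty(\Omega;\mathbb R^{2\times2})$ with $K(x)$ positive definite for a.e. $x\in\Omega$, let $f\in L^2(\Omega)$, and let $g$ be the boundary value on $\partial\Omega$ of a function in $H^1(\Omega)$. Write $(\cdot,\cdot)_V$ for the $L^2(V)$ inner product, $H^1_0(V)$ for the closure of $C_c^\infty(V)$ in $H^1(V)$, and understand equality of boundary values on $\partial V$ of two functions in $H^1(V)$ as membership of their difference in $H^1_0(V)$. Put $H^1_g(\Omega)=\{p\in H^1(\Omega): p|_{\partial\Omega}=g\}$. The global problem is: find $(\mathbf u,p)\in L^2(\Omega)^2\times H^1_g(\Omega)$ with $$(\mathbf u,\mathbf v)_\Omega-(K\nabla p,\mathbf v)_\Omega=0\quad\forall\,\mathbf v\in L^2(\Omega)^2,\qquad (\mathbf u,\nabla w)_\Omega=(f,w)_\Omega\quad\forall\,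 w\in H^1_0(\Omega).\tag{1}$$ Let $H^\gamma\subset H^1(\Omega)$ be the space of all $v$ with $(v,w)_{H^1(\Omega_i)}=0$ for all $i$ and all $w\in H^1_0(\Omega_i)$, and let $H^\gamma_g$ and $H^\gamma_0$ be the sets of $v\in H^\gamma$ with $v|_{\partial\Omega}=g$ and $v|_{\partial\Omega}=0$, respectively. For $\lambda\in H^\gamma$ let $(\mathbf u^*(\lambda),p^*(\lambda))\in L^2(\Omega)^2\times H^1(\Omega)$ solve, for every $1\le i\le n$, $$(\mathbf u^*(\lambda),\mathbf v)_{\Omega_i}-(K\nabla p^*(\lambda),\mathbf v)_{\Omega_i}=0\ \ \forall\,\mathbf v\in L^2(\Omega_i)^2,\qquad(\mathbf u^*(\lambda),\nabla w)_{\Omega_i}=0\ \ \forall\, w\in H^1_0(\Omega_i),\qquad p^*(\lambda)|_{\Gamma_i}=\lambda|_{\Gamma_i},$$ and let $(\bar{\mathbf u},\bar p)\in L^2(\Omega)^2\times H^1_0(\Omega)$ solve, for every $1\le i\le n$, $$(\bar{\mathbf u},\mathbf v)_{\Omega_i}-(K\nabla\bar p,\mathbf v)_{\Omega_i}=0\ \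 \forall\,\mathbf v\in L^2(\Omega_i)^2,\qquad(\bar{\mathbf u},\nabla w)_{\Omega_i}=(f,w)_{\Omega_i}\ \ \forall\, w\in H^1_0(\Omega_i),\qquad \bar p|_{\Gamma_i}=0.$$ Define $$b(\lambda,\mu)=\sum_{i=1}^n(\mathbf u^*(\lambda),\nabla\mu)_{\Omega_i},\qquad L(\mu)=(f,\mu)_\Omega-\sum_{i=1}^n(\bar{\mathbf u},\nabla\mu)_{\Omega_i}.$$ Suppose $\lambda\in H^\gamma_g$ satisfies $b(\lambda,\mu)=L(\mu)$ for all $\mu\in H^\gamma_0$. Then $\mathbf u:=\mathbf u^*(\lambda)+\bar{\mathbf u}$, $p:=p^*(\lambda)+\bar p$ is the solution of (1): it solves (1), and every solution of (1) equals it. -/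

import Mathlib

open MeasureTheory Set
open scoped ContDiff

noncomputable section

namespace Mortar

/-- The Euclidean plane. -/
abbrev Plane : Type := EuclideanSpace ℝ (Fin 2)

/-- The space `L²(U; F)` (with `F = ℝ` or `F = ℝ²` below). -/
abbrev L2 (U : Set Plane) (F : Type) [NormedAddCommGroup F] : Type :=
  Lp F 2 (volume.restrict U)

/-- The pairing `(u, v)_V = ∫_V u · v`. -/
def pairing {F : Type} [NormedAddCommGroup F] [InnerProductSpace ℝ F]
    (V : Set Plane) (u v : Plane → F) : ℝ :=
  ∫ x in V, inner ℝ (u x) (v x)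

/-- `φ ∈ C_c^∞(U)`. -/
structure IsTest (U : Set Plane) (φ : Plane → ℝ) : Prop where
  smooth : ContDiff ℝ ∞ φ
  compact : HasCompactSupport φ
  supp : tsupport φ ⊆ U

/-- `G` is the weak gradient of `u` on `U`: `∫_U u ∇φ = - ∫_U φ G` for all `φ ∈ C_c^∞(U)`. -/
def IsWeakGradient (U : Set Plane) (u : Plane → ℝ) (G : Plane → Plane) : Prop :=
  ∀ φ : Plane → ℝ, IsTest U φ →
    ∫ x in U, u x • gradient φ x = - ∫ x in U, φ x • G x

theorem IsTest.continuous_gradient {U : Set Plane} {φ : Plane → ℝ} (h : IsTest U φ) :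
    Continuous (gradient φ) :=
  (InnerProductSpace.toDual ℝ Plane).symm.continuous.comp
    (h.smooth.continuous_fderiv (by simp))

theorem IsTest.compact_gradient {U : Set Plane} {φ : Plane → ℝ} (h : IsTest U φ) :
    HasCompactSupport (gradient φ) :=
  (h.compact.fderiv (𝕜 := ℝ)).comp_left
    (g := (InnerProductSpace.toDual ℝ Plane).symm) (map_zero _)

theorem IsTest.integrable_left {U : Set Plane} {φ : Plane → ℝ} (h : IsTest U φ)
    (u : L2 U ℝ) : Integrable (fun x => u x • gradient φ x) (volume.restrict U) :=
  ((Lp.memLp u).locallyIntegrable (by norm_num)).integrable_smul_right_of_hasCompactSupport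
    h.continuous_gradient h.compact_gradient

theorem IsTest.integrable_right {U : Set Plane} {φ : Plane → ℝ} (h : IsTest U φ)
    (G : L2 U Plane) : Integrable (fun x => φ x • G x) (volume.restrict U) :=
  ((Lp.memLp G).locallyIntegrable (by norm_num)).integrable_smul_left_of_hasCompactSupport
    h.smooth.continuous h.compact

/-- The Sobolev space `H¹(U)`: pairs `(u, ∇u)` of an `L²` function and its weak gradient, which is
in `L²` and which `u` determines.  The inner product inherited from the `ℓ²`-product is
`(u, v)_{H¹(U)} = (u, v)_U + (∇u, ∇v)_U`. -/
def H1 (U : Set Plane) : Submodule ℝ (WithLp 2 (L2 U ℝ × L2 U Plane)) where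
  carrier := {z | IsWeakGradient U z.fst z.snd}
  zero_mem' := by
    intro φ _
    have h1 : ∫ x in U, ((0 : L2 U ℝ) : Plane → ℝ) x • gradient φ x = 0 := by
      refine integral_eq_zero_of_ae ?_
      filter_upwards [Lp.coeFn_zero ℝ 2 (volume.restrict U)] with x hx
      rw [hx, Pi.zero_apply, zero_smul]; rfl
    have h2 : ∫ x in U, φ x • ((0 : L2 U Plane) : Plane → Plane) x = 0 := by
      refine integral_eq_zero_of_ae ?_
      filter_upwards [Lp.coeFn_zero Plane 2 (volume.restrict U)] with x hx
      rw [hx, Pi.zero_apply, smul_zero]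
    exact h1.trans (by rw [← neg_zero, ← h2]; rfl)
  add_mem' := by
    intro a b ha hb φ hφ
    have h1 : ∫ x in U, (a.fst + b.fst : L2 U ℝ) x • gradient φ x
        = (∫ x in U, a.fst x • gradient φ x) + ∫ x in U, b.fst x • gradient φ x := by
      rw [← integral_add (hφ.integrable_left _) (hφ.integrable_left _)]
      refine integral_congr_ae ?_
      filter_upwards [Lp.coeFn_add a.fst b.fst] with x hx
      rw [hx, Pi.add_apply, add_smul]
    have h2 : ∫ x in U, φ x • (a.snd + b.snd : L2 U Plane) x
        = (∫ x in U, φ x • a.snd x) + ∫ x in U, φ x • b.snd x := by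
      rw [← integral_add (hφ.integrable_right _) (hφ.integrable_right _)]
      refine integral_congr_ae ?_
      filter_upwards [Lp.coeFn_add a.snd b.snd] with x hx
      rw [hx, Pi.add_apply, smul_add]
    change ∫ x in U, (a.fst + b.fst : L2 U ℝ) x • gradient φ x
      = - ∫ x in U, φ x • (a.snd + b.snd : L2 U Plane) x
    rw [h1, h2, ha φ hφ, hb φ hφ, neg_add]
  smul_mem' := by
    intro c a ha φ hφ
    have h1 : ∫ x in U, (c • a.fst : L2 U ℝ) x • gradient φ x
        = c • ∫ x in U, a.fst x • gradient φ x := by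
      rw [← integral_smul]
      refine integral_congr_ae ?_
      filter_upwards [Lp.coeFn_smul c a.fst] with x hx
      rw [hx, Pi.smul_apply, smul_assoc]
    have h2 : ∫ x in U, φ x • (c • a.snd : L2 U Plane) x
        = c • ∫ x in U, φ x • a.snd x := by
      rw [← integral_smul]
      refine integral_congr_ae ?_
      filter_upwards [Lp.coeFn_smul c a.snd] with x hx
      rw [hx, Pi.smul_apply, smul_comm]
    change ∫ x in U, (c • a.fst : L2 U ℝ) x • gradient φ x
      = - ∫ x in U, φ x • (c • a.snd : L2 U Plane) x
    rw [h1, h2, ha φ hφ, smul_neg]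

/-- The `L²` function underlying an element of `H¹(U)`. -/
def fn {U : Set Plane} (z : H1 U) : L2 U ℝ := z.1.fst

/-- The weak gradient of an element of `H¹(U)`. -/
def wgrad {U : Set Plane} (z : H1 U) : L2 U Plane := z.1.snd

/-- `C_c^∞(U)` as a subspace of `H¹(U)`. -/
def testSubspace (U : Set Plane) : Submodule ℝ (H1 U) where
  carrier := {z | ∃ φ : Plane → ℝ, IsTest U φ ∧
    (fn z : Plane → ℝ) =ᵐ[volume.restrict U] φ ∧
    (wgrad z : Plane → Plane) =ᵐ[volume.restrict U] gradient φ}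
  zero_mem' := by
    refine ⟨0, ⟨contDiff_const, HasCompactSupport.zero, by simp [tsupport]⟩,
      Lp.coeFn_zero ℝ 2 (volume.restrict U), ?_⟩
    filter_upwards [Lp.coeFn_zero Plane 2 (volume.restrict U)] with x hx
    refine hx.trans ?_
    simp [gradient]
  add_mem' := by
    rintro a b ⟨φ, hφ, ha, ha'⟩ ⟨ψ, hψ, hb, hb'⟩
    refine ⟨φ + ψ, ⟨hφ.smooth.add hψ.smooth, hφ.compact.add hψ.compact,
      (tsupport_add φ ψ).trans (union_subset hφ.supp hψ.supp)⟩, ?_, ?_⟩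
    · filter_upwards [Lp.coeFn_add (fn a) (fn b), ha, hb] with x hx h1 h2
      refine hx.trans ?_
      simp [h1, h2]
    · filter_upwards [Lp.coeFn_add (wgrad a) (wgrad b), ha', hb'] with x hx h1 h2
      refine hx.trans ?_
      simp only [Pi.add_apply, h1, h2, gradient]
      rw [fderiv_add (hφ.smooth.differentiable (by simp) x)
        (hψ.smooth.differentiable (by simp) x), map_add]
  smul_mem' := by
    rintro c a ⟨φ, hφ, ha, ha'⟩
    refine ⟨c • φ, ⟨hφ.smooth.const_smul c, hφ.compact.smul_left (f := fun _ => c),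
      (tsupport_smul_subset_right (fun _ => c) φ).trans hφ.supp⟩, ?_, ?_⟩
    · filter_upwards [Lp.coeFn_smul c (fn a), ha] with x hx h1
      refine hx.trans ?_
      simp [h1]
    · filter_upwards [Lp.coeFn_smul c (wgrad a), ha'] with x hx h1
      refine hx.trans ?_
      simp only [Pi.smul_apply, h1, gradient]
      rw [fderiv_const_smul (hφ.smooth.differentiable (by simp) x)]
      simp

/-- `H¹₀(U)`, the closure of `C_c^∞(U)` in `H¹(U)`. -/
def H10 (U : Set Plane) : Submodule ℝ (H1 U) := (testSubspace U).topologicalClosure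

/-- The space of boundary values of `H¹(U)`; for a Lipschitz domain it is `H^{1/2}(∂U)`, since
`H¹₀(U)` is the kernel of the trace. -/
abbrev TraceSpace (U : Set Plane) : Type := H1 U ⧸ H10 U

/-- The boundary value `u|_{∂U}` of `u ∈ H¹(U)`: two functions have the same boundary value iff
they differ by an element of `H¹₀(U)`. -/
def trace {U : Set Plane} : H1 U →ₗ[ℝ] TraceSpace U := (H10 U).mkQ

/-- Restriction `L²(U; F) → L²(V; F)` for `V ⊆ U`. -/
def restrictL2 {U V : Set Plane} (h : V ⊆ U) (F : Type) [NormedAddCommGroup F] [NormedSpace ℝ F] :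
    L2 U F →ₗ[ℝ] L2 V F where
  toFun f := ((Lp.memLp f).mono_measure (Measure.restrict_mono h le_rfl)).toLp f
  map_add' f g := by
    rw [← MemLp.toLp_add]
    exact MemLp.toLp_congr _ _ (ae_mono (Measure.restrict_mono h le_rfl) (Lp.coeFn_add f g))
  map_smul' c f := by
    rw [RingHom.id_apply, ← MemLp.toLp_const_smul]
    exact MemLp.toLp_congr _ _ (ae_mono (Measure.restrict_mono h le_rfl) (Lp.coeFn_smul c f))

theorem restrictL2_ae {U V : Set Plane} (h : V ⊆ U) {F : Type} [NormedAddCommGroup F]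
    [NormedSpace ℝ F] (f : L2 U F) :
    (restrictL2 h F f : Plane → F) =ᵐ[volume.restrict V] f :=
  MemLp.coeFn_toLp ((Lp.memLp f).mono_measure (Measure.restrict_mono h le_rfl))

theorem IsWeakGradient.restrict {U V : Set Plane} (h : V ⊆ U) {u : L2 U ℝ} {G : L2 U Plane}
    (hG : IsWeakGradient U u G) :
    IsWeakGradient V (restrictL2 h ℝ u) (restrictL2 h Plane G) := by
  intro φ hφ
  have hU : IsTest U φ := ⟨hφ.smooth, hφ.compact, hφ.supp.trans h⟩
  have z1 : ∀ W : Set Plane, IsTest W φ → ∀ x, x ∉ W → gradient φ x = 0 := by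
    intro W hW x hx
    have : fderiv ℝ φ x = 0 := image_eq_zero_of_notMem_tsupport
      (fun hx' => hx (hW.supp (tsupport_fderiv_subset ℝ hx')))
    simp [gradient, this]
  have z2 : ∀ W : Set Plane, IsTest W φ → ∀ x, x ∉ W → φ x = 0 := fun W hW x hx =>
    image_eq_zero_of_notMem_tsupport (fun hx' => hx (hW.supp hx'))
  have e1 : ∫ x in V, restrictL2 h ℝ u x • gradient φ x = ∫ x in U, u x • gradient φ x := by
    rw [integral_congr_ae (g := fun x => u x • gradient φ x)
      (by filter_upwards [restrictL2_ae h u] with x hx; rw [hx]),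
      setIntegral_eq_integral_of_forall_compl_eq_zero (fun x hx => by rw [z1 V hφ x hx, smul_zero]),
      setIntegral_eq_integral_of_forall_compl_eq_zero (fun x hx => by rw [z1 U hU x hx, smul_zero])]
  have e2 : ∫ x in V, φ x • restrictL2 h Plane G x = ∫ x in U, φ x • G x := by
    rw [integral_congr_ae (g := fun x => φ x • G x)
      (by filter_upwards [restrictL2_ae h G] with x hx; rw [hx]),
      setIntegral_eq_integral_of_forall_compl_eq_zero (fun x hx => by rw [z2 V hφ x hx, zero_smul]),
      setIntegral_eq_integral_of_forall_compl_eq_zero (fun x hx => by rw [z2 U hU x hx, zero_smul])]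
  rw [e1, e2, hG φ hU]

/-- Restriction `H¹(U) → H¹(V)` for `V ⊆ U`. -/
def restrictH1 {U V : Set Plane} (h : V ⊆ U) : H1 U →ₗ[ℝ] H1 V where
  toFun z := ⟨WithLp.toLp 2 (restrictL2 h ℝ (fn z), restrictL2 h Plane (wgrad z)),
    IsWeakGradient.restrict h z.2⟩
  map_add' a b := by
    apply Subtype.ext
    exact congrArg (WithLp.toLp 2) (Prod.ext (map_add (restrictL2 h ℝ) (fn a) (fn b))
      (map_add (restrictL2 h Plane) (wgrad a) (wgrad b)))
  map_smul' c a := by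
    apply Subtype.ext
    exact congrArg (WithLp.toLp 2) (Prod.ext (map_smul (restrictL2 h ℝ) c (fn a))
      (map_smul (restrictL2 h Plane) c (wgrad a)))

/-- A bounded open set whose boundary is covered by finitely many line segments. -/
structure IsPolygonal (U : Set Plane) : Prop where
  isOpen : IsOpen U
  isBounded : Bornology.IsBounded U
  frontier_subset : ∃ S : Finset (Plane × Plane), frontier U ⊆ ⋃ s ∈ S, segment ℝ s.1 s.2

/-- A division of `Ω` into `n` non-overlapping polygonal subdomains `Ω_i`. -/
structure PolygonalPartition (Ω : Set Plane) (n : ℕ) where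
  part : Fin n → Set Plane
  polygonal : ∀ i, IsPolygonal (part i)
  subset : ∀ i, part i ⊆ Ω
  disjoint : Pairwise (fun i j => Disjoint (part i) (part j))
  cover : closure Ω = ⋃ i, closure (part i)

/-- `K ∈ L^∞(Ω; ℝ^{2×2})` with `K(x)` positive definite for a.e. `x ∈ Ω`
(symmetry is not required). -/
structure IsCoefficient (Ω : Set Plane) (K : Plane → Matrix (Fin 2) (Fin 2) ℝ) : Prop where
  bounded : ∀ i j, MemLp (fun x => K x i j) ⊤ (volume.restrict Ω)
  posDef : ∀ᵐ x ∂(volume.restrict Ω), ∀ ξ : Plane, ξ ≠ 0 →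
    0 < inner ℝ ((K x).toEuclideanLin ξ) ξ

/-- The vector field `x ↦ K(x) ∇p(x)`. -/
def flux {Ω : Set Plane} (K : Plane → Matrix (Fin 2) (Fin 2) ℝ) (p : H1 Ω) : Plane → Plane :=
  fun x => (K x).toEuclideanLin (wgrad p x)

/-- `(u, p) ∈ L²(Ω)² × H¹_g(Ω)` solves the global problem
`(u, v) - (K∇p, v) = 0` for all `v ∈ L²(Ω)²`, `(u, ∇w) = (f, w)` for all `w ∈ H¹₀(Ω)`. -/
structure IsGlobalSolution {Ω : Set Plane} (K : Plane → Matrix (Fin 2) (Fin 2) ℝ) (f : L2 Ω ℝ)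
    (g : TraceSpace Ω) (u : L2 Ω Plane) (p : H1 Ω) : Prop where
  boundary : trace p = g
  constitutive : ∀ v : L2 Ω Plane, pairing Ω u v - pairing Ω (flux K p) v = 0
  balance : ∀ w ∈ H10 Ω, pairing Ω u (wgrad w) = pairing Ω f (fn w)

variable {Ω : Set Plane} {n : ℕ} (D : PolygonalPartition Ω n)

/-- `H^γ(Ω)`: the functions of `H¹(Ω)` that are `H¹`-orthogonal to `H¹₀(Ω_i)` for every `i`. -/
def Hgamma : Submodule ℝ (H1 Ω) where
  carrier := {v | ∀ i, ∀ w ∈ H10 (D.part i), inner ℝ (restrictH1 (D.subset i) v) w = 0}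
  zero_mem' := by intro i w _; simp
  add_mem' := by
    intro a b ha hb i w hw
    rw [map_add, inner_add_left, ha i w hw, hb i w hw, add_zero]
  smul_mem' := by
    intro c a ha i w hw
    rw [map_smul]
    exact (real_inner_smul_left (restrictH1 (D.subset i) a) w c).trans (by rw [ha i w hw, mul_zero])

/-- `H^γ_g(Ω) = {v ∈ H^γ(Ω) | v|_{∂Ω} = g}`. -/
def HgammaBC (g : TraceSpace Ω) : Set (H1 Ω) := {v | v ∈ Hgamma D ∧ trace v = g}

/-- `(u*, p*) ∈ L²(Ω)² × H¹(Ω)` solves the local problems with zero source and with Dirichlet data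
`ν` on every `∂Ω_i`. -/
structure IsStarSolution (K : Plane → Matrix (Fin 2) (Fin 2) ℝ) (ν : H1 Ω)
    (u : L2 Ω Plane) (p : H1 Ω) : Prop where
  boundary : ∀ i, trace (restrictH1 (D.subset i) p) = trace (restrictH1 (D.subset i) ν)
  constitutive : ∀ i, ∀ v : L2 (D.part i) Plane,
    pairing (D.part i) u v - pairing (D.part i) (flux K p) v = 0
  balance : ∀ i, ∀ w ∈ H10 (D.part i), pairing (D.part i) u (wgrad w) = 0

/-- `(ū, p̄) ∈ L²(Ω)² × H¹₀(Ω)` solves the local problems with source `f` and with zero Dirichlet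
data on every `∂Ω_i`. -/
structure IsBarSolution (K : Plane → Matrix (Fin 2) (Fin 2) ℝ) (f : L2 Ω ℝ)
    (u : L2 Ω Plane) (p : H1 Ω) : Prop where
  mem_H10 : p ∈ H10 Ω
  boundary : ∀ i, trace (restrictH1 (D.subset i) p) = 0
  constitutive : ∀ i, ∀ v : L2 (D.part i) Plane,
    pairing (D.part i) u v - pairing (D.part i) (flux K p) v = 0
  balance : ∀ i, ∀ w ∈ H10 (D.part i),
    pairing (D.part i) u (wgrad w) = pairing (D.part i) f (fn w)

/-- `b(ν, μ) = ∑_i (u*(ν), ∇μ)_{Ω_i}`. -/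
def interfaceForm (uStar : H1 Ω → L2 Ω Plane) (ν μ : H1 Ω) : ℝ :=
  ∑ i, pairing (D.part i) (uStar ν) (wgrad μ)

/-- `L(μ) = (f, μ)_Ω - ∑_i (ū, ∇μ)_{Ω_i}`. -/
def loadFunctional (f : L2 Ω ℝ) (uBar : L2 Ω Plane) (μ : H1 Ω) : ℝ :=
  pairing Ω f (fn μ) - ∑ i, pairing (D.part i) uBar (wgrad μ)

end Mortar

end

namespace Mortar

/-! The argument rests on splitting the test space. Let `w ∈ H¹₀(Ω)` and project each restriction
`w|Ω_i` orthogonally, in `H¹(Ω_i)`, onto `H¹₀(Ω_i)`. Extended by zero and summed, the projections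
form `W ∈ H¹₀(Ω)`, and the residual `μ = w - W` lies in `H^γ` with zero boundary value
(`exists_decomposition`). The local balance equations handle `W`, the interface equation handles
`μ`, and adding the two gives the global balance.

The other conditions also pass from the pieces to `Ω`. The polygonal boundaries are null sets, so
the `Ω_i` exhaust `Ω` almost everywhere, and the constitutive law, being equivalent to `u = K∇p`
a.e., can be checked piecewise. The boundary condition holds because a function of `H¹(Ω)` whose
restrictions lie in every `H¹₀(Ω_i)` lies in `H¹₀(Ω)` (`mem_H10_of_restrict`).

For uniqueness, the difference of two pressures is in `H¹₀(Ω)` and has zero energy. Pointwise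
positive definiteness of `K` makes its gradient vanish, with no uniform ellipticity required, and
the Poincaré inequality makes the difference itself vanish. -/

/-! ### Pairings as `L²` inner products -/

theorem pairing_eq_inner {F : Type} [NormedAddCommGroup F] [InnerProductSpace ℝ F]
    {V : Set Plane} (u v : L2 V F) : pairing V u v = inner ℝ u v := rfl

theorem pairing_congr {F : Type} [NormedAddCommGroup F] [InnerProductSpace ℝ F]
    {V : Set Plane} {u u' v v' : Plane → F} (hu : u =ᵐ[volume.restrict V] u')
    (hv : v =ᵐ[volume.restrict V] v') : pairing V u v = pairing V u' v' := by
  refine integral_congr_ae ?_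
  filter_upwards [hu, hv] with x h1 h2
  rw [h1, h2]

theorem pairing_restrict {F : Type} [NormedAddCommGroup F] [InnerProductSpace ℝ F]
    {U V : Set Plane} (h : V ⊆ U) (u v : L2 U F) :
    pairing V u v = inner ℝ (restrictL2 h F u) (restrictL2 h F v) :=
  pairing_congr (restrictL2_ae h u).symm (restrictL2_ae h v).symm

/-- Two square integrable fields with the same pairings against `L²` agree almost everywhere. -/
theorem ae_eq_iff_pairing {F : Type} [NormedAddCommGroup F] [InnerProductSpace ℝ F]
    {V : Set Plane} {a b : Plane → F} (ha : MemLp a 2 (volume.restrict V))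
    (hb : MemLp b 2 (volume.restrict V)) :
    (∀ v : L2 V F, pairing V a v - pairing V b v = 0) ↔ a =ᵐ[volume.restrict V] b := by
  constructor
  · intro h
    rw [← MemLp.toLp_eq_toLp_iff ha hb]
    refine ext_inner_right ℝ fun v => ?_
    rw [← pairing_eq_inner, ← pairing_eq_inner, pairing_congr ha.coeFn_toLp ae_eq_rfl,
      pairing_congr hb.coeFn_toLp ae_eq_rfl]
    exact sub_eq_zero.1 (h v)
  · intro h v
    rw [pairing_congr h ae_eq_rfl, sub_self]

/-! ### Closedness of `H¹(U)` -/

theorem IsTest.memLp_inner_gradient {U : Set Plane} {φ : Plane → ℝ} (h : IsTest U φ) (e : Plane) :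
    MemLp (fun x => inner ℝ e (gradient φ x)) 2 (volume.restrict U) :=
  (continuous_const.inner h.continuous_gradient).memLp_of_hasCompactSupport
    (h.compact_gradient.comp_left (g := fun y => inner ℝ e y) (inner_zero_right e))

theorem IsTest.memLp_smul_const {U : Set Plane} {φ : Plane → ℝ} (h : IsTest U φ) (e : Plane) :
    MemLp (fun x => φ x • e) 2 (volume.restrict U) :=
  (h.smooth.continuous.smul continuous_const).memLp_of_hasCompactSupport
    (h.compact.comp_left (g := fun t => t • e) (zero_smul ℝ e))

/-- Taking the component along a fixed vector `e` turns each side into an inner product with a fixed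
`L²` element, so each condition is visibly continuous in `z`. -/
theorem isWeakGradient_iff {U : Set Plane} (z : WithLp 2 (L2 U ℝ × L2 U Plane)) :
    IsWeakGradient U z.fst z.snd ↔ ∀ (φ : Plane → ℝ) (h : IsTest U φ) (e : Plane),
      inner ℝ ((h.memLp_inner_gradient e).toLp _) z.fst
        = - inner ℝ ((h.memLp_smul_const e).toLp _) z.snd := by
  refine forall_congr' fun φ => forall_congr' fun h => ?_
  refine (ext_iff_inner_left ℝ).trans (forall_congr' fun e => ?_)
  have h1 : inner ℝ e (∫ x in U, z.fst x • gradient φ x)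
      = inner ℝ ((h.memLp_inner_gradient e).toLp _) z.fst := by
    rw [← integral_inner (h.integrable_left _), L2.inner_def]
    refine integral_congr_ae ?_
    filter_upwards [(h.memLp_inner_gradient e).coeFn_toLp] with x hx
    rw [hx, inner_smul_right]
    rfl
  have h2 : inner ℝ e (∫ x in U, φ x • z.snd x)
      = inner ℝ ((h.memLp_smul_const e).toLp _) z.snd := by
    rw [← integral_inner (h.integrable_right _), L2.inner_def]
    refine integral_congr_ae ?_
    filter_upwards [(h.memLp_smul_const e).coeFn_toLp] with x hx
    rw [hx, inner_smul_right, real_inner_smul_left]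
  rw [inner_neg_right, h1, h2]

theorem isClosed_H1 (U : Set Plane) :
    IsClosed (H1 U : Set (WithLp 2 (L2 U ℝ × L2 U Plane))) := by
  have : (H1 U : Set (WithLp 2 (L2 U ℝ × L2 U Plane))) =
      ⋂ (φ : Plane → ℝ) (h : IsTest U φ) (e : Plane), {z |
        inner ℝ ((h.memLp_inner_gradient e).toLp _) z.fst
          = - inner ℝ ((h.memLp_smul_const e).toLp _) z.snd} := by
    ext z
    simp only [mem_iInter, mem_ofPred_eq]
    exact isWeakGradient_iff z
  rw [this]
  refine isClosed_iInter fun φ => isClosed_iInter fun h => isClosed_iInter fun e => ?_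
  exact isClosed_eq (continuous_const.inner (WithLp.continuous_fst 2 _ _))
    (continuous_const.inner (WithLp.continuous_snd 2 _ _)).neg

instance completeSpace_H1 (U : Set Plane) : CompleteSpace (H1 U) :=
  (isClosed_H1 U).completeSpace_coe

/-- Completeness supplies the orthogonal projection onto `H¹₀(Ω_i)` that yields the decomposition of
test functions. -/
instance completeSpace_H10 (U : Set Plane) : CompleteSpace (H10 U) :=
  (Submodule.isClosed_topologicalClosure _).completeSpace_coe

theorem H1_ext {U : Set Plane} {a b : H1 U} (h1 : fn a = fn b) (h2 : wgrad a = wgrad b) :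
    a = b :=
  Subtype.ext (WithLp.ofLp_injective 2 (Prod.ext h1 h2))

theorem continuous_fn (U : Set Plane) : Continuous (fn : H1 U → L2 U ℝ) :=
  (WithLp.continuous_fst 2 _ _).comp continuous_subtype_val

theorem continuous_wgrad (U : Set Plane) : Continuous (wgrad : H1 U → L2 U Plane) :=
  (WithLp.continuous_snd 2 _ _).comp continuous_subtype_val

/-! ### Extension by zero -/

section Extension

variable {U V : Set Plane} {F : Type} [NormedAddCommGroup F]

theorem memLp_indicator_of_subset (h : V ⊆ U) (hV : MeasurableSet V) (f : L2 V F) :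
    MemLp (V.indicator f) 2 (volume.restrict U) := by
  rw [memLp_indicator_iff_restrict hV, Measure.restrict_restrict hV, inter_eq_left.2 h]
  exact Lp.memLp f

theorem indicator_ae_of_ae_restrict (h : V ⊆ U) (hV : MeasurableSet V) {a b : Plane → F}
    (hab : a =ᵐ[volume.restrict V] b) :
    V.indicator a =ᵐ[volume.restrict U] V.indicator b := by
  rw [← inter_eq_left.2 h, ← Measure.restrict_restrict hV, Filter.EventuallyEq,
    ae_restrict_iff' hV] at hab
  filter_upwards [hab] with x hx
  by_cases hxV : x ∈ V
  · rw [indicator_of_mem hxV, indicator_of_mem hxV, hx hxV]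
  · rw [indicator_of_notMem hxV, indicator_of_notMem hxV]

variable [NormedSpace ℝ F]

/-- Extension by zero `L²(V; F) → L²(U; F)` for `V ⊆ U`. -/
noncomputable def extendL2 (h : V ⊆ U) (hV : MeasurableSet V) : L2 V F →ₗᵢ[ℝ] L2 U F where
  toFun f := (memLp_indicator_of_subset h hV f).toLp _
  map_add' f g := by
    rw [← MemLp.toLp_add]
    refine MemLp.toLp_congr _ _ ?_
    rw [← indicator_add']
    exact indicator_ae_of_ae_restrict h hV (Lp.coeFn_add f g)
  map_smul' c f := by
    rw [RingHom.id_apply, ← MemLp.toLp_const_smul]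
    refine MemLp.toLp_congr _ _ ?_
    refine (indicator_ae_of_ae_restrict h hV (Lp.coeFn_smul c f)).trans ?_
    exact .of_eq (indicator_const_smul V c f)
  norm_map' f := by
    change ‖(memLp_indicator_of_subset h hV f).toLp _‖ = ‖f‖
    rw [Lp.norm_toLp, Lp.norm_def, eLpNorm_indicator_eq_eLpNorm_restrict hV,
      Measure.restrict_restrict hV, inter_eq_left.2 h]

theorem extendL2_ae (h : V ⊆ U) (hV : MeasurableSet V) (f : L2 V F) :
    (extendL2 h hV f : Plane → F) =ᵐ[volume.restrict U] V.indicator f :=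
  (memLp_indicator_of_subset h hV f).coeFn_toLp

theorem restrictL2_extendL2 (h : V ⊆ U) (hV : MeasurableSet V) (f : L2 V F) :
    restrictL2 h F (extendL2 h hV f) = f := by
  refine Lp.ext ?_
  filter_upwards [restrictL2_ae h (extendL2 h hV f),
    ae_mono (Measure.restrict_mono h le_rfl) (extendL2_ae h hV f), ae_restrict_mem hV]
    with x h1 h2 h3
  rw [h1, h2, indicator_of_mem h3]

theorem restrictL2_extendL2_of_disjoint {W : Set Plane} (h : V ⊆ U) (hV : MeasurableSet V)
    (hW : W ⊆ U) (hW' : MeasurableSet W) (hd : Disjoint V W) (f : L2 V F) :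
    restrictL2 hW F (extendL2 h hV f) = 0 := by
  refine Lp.ext ?_
  filter_upwards [restrictL2_ae hW (extendL2 h hV f),
    ae_mono (Measure.restrict_mono hW le_rfl) (extendL2_ae h hV f), ae_restrict_mem hW',
    Lp.coeFn_zero F 2 (volume.restrict W)] with x h1 h2 h3 h4
  rw [h1, h2, h4, indicator_of_notMem (disjoint_right.1 hd h3), Pi.zero_apply]

end Extension

/-- Taking the closure in the ambient product allows limits to be mapped before their images are
known to lie in `H¹`. -/
theorem mem_H10_iff {U : Set Plane} (z : H1 U) :
    z ∈ H10 U ↔ (z : WithLp 2 (L2 U ℝ × L2 U Plane)) ∈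
      closure (Subtype.val '' (testSubspace U : Set (H1 U))) :=
  closure_subtype

/-- A test function on `V ⊆ U` is its own extension by zero. -/
theorem IsTest.indicator_eq {V : Set Plane} {φ : Plane → ℝ} (hφ : IsTest V φ) :
    V.indicator φ = φ :=
  indicator_eq_self.2 ((subset_tsupport φ).trans hφ.supp)

theorem IsTest.indicator_gradient_eq {V : Set Plane} {φ : Plane → ℝ} (hφ : IsTest V φ) :
    V.indicator (gradient φ) = gradient φ := by
  refine indicator_eq_self.2 fun x hx => by_contra fun hxV => hx ?_
  have : fderiv ℝ φ x = 0 := image_eq_zero_of_notMem_tsupport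
    (fun hx' => hxV (hφ.supp (tsupport_fderiv_subset ℝ hx')))
  simp [gradient, this]

/-- Both functions have compact support in `U`, so the integrals extend to the whole plane, where
integration by parts has no boundary term. -/
theorem IsTest.isWeakGradient {U : Set Plane} {φ : Plane → ℝ} (hφ : IsTest U φ) :
    IsWeakGradient U φ (gradient φ) := by
  intro ψ hψ
  have hz : ∀ x, x ∉ U → gradient φ x = 0 := fun x hx => by
    rw [← hφ.indicator_gradient_eq, indicator_of_notMem hx]
  have hz' : ∀ x, x ∉ U → gradient ψ x = 0 := fun x hx => by
    rw [← hψ.indicator_gradient_eq, indicator_of_notMem hx]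
  rw [setIntegral_eq_integral_of_forall_compl_eq_zero
      (fun x hx => by rw [hz' x hx, smul_zero]),
    setIntegral_eq_integral_of_forall_compl_eq_zero
      (fun x hx => by rw [hz x hx, smul_zero])]
  have i1 : Integrable (fun x => φ x • gradient ψ x) :=
    (hφ.smooth.continuous.smul hψ.continuous_gradient).integrable_of_hasCompactSupport
      (hφ.compact.smul_right)
  have i2 : Integrable (fun x => ψ x • gradient φ x) :=
    (hψ.smooth.continuous.smul hφ.continuous_gradient).integrable_of_hasCompactSupport
      (hψ.compact.smul_right)
  refine ext_inner_left ℝ fun e => ?_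
  rw [inner_neg_right, ← integral_inner i1, ← integral_inner i2]
  have hg : ∀ (a χ : Plane → ℝ) (x : Plane),
      inner ℝ e (a x • gradient χ x) = a x * fderiv ℝ χ x e := fun a χ x => by
    rw [inner_smul_right, gradient, real_inner_comm, InnerProductSpace.toDual_symm_apply]
  have j1 := i1.const_inner (𝕜 := ℝ) e
  have j2 := i2.const_inner (𝕜 := ℝ) e
  simp_rw [hg] at j1 j2 ⊢
  have key := integral_mul_fderiv_eq_neg_fderiv_mul_of_integrable
    (by simpa only [mul_comm] using j2) j1
    ((hφ.smooth.continuous.mul hψ.smooth.continuous).integrable_of_hasCompactSupport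
      hφ.compact.mul_right)
    (fun x _ => hφ.smooth.differentiable (by simp) x)
    (fun x _ => hψ.smooth.differentiable (by simp) x)
  simpa only [mul_comm] using key

/-- Extension by zero maps `H¹₀(V)` to `H¹₀(U)` for `V ⊆ U`. -/
theorem exists_extension_mem_H10 {U V : Set Plane} (h : V ⊆ U) (hV : MeasurableSet V)
    {w : H1 V} (hw : w ∈ H10 V) :
    ∃ W ∈ H10 U, fn W = extendL2 h hV (fn w) ∧ wgrad W = extendL2 h hV (wgrad w) := by
  -- Extension by zero need not preserve weak differentiability on all of `H¹(V)`. It is therefore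
  -- set up on pairs of `L²` functions, and only limits of test functions are shown to land in
  -- `H¹(U)`.
  let E : WithLp 2 (L2 V ℝ × L2 V Plane) → WithLp 2 (L2 U ℝ × L2 U Plane) := fun z =>
    WithLp.toLp 2 (extendL2 h hV z.fst, extendL2 h hV z.snd)
  have hE : Continuous E := (WithLp.prod_continuous_toLp 2 _ _).comp
    (((extendL2 h hV).continuous.comp (WithLp.continuous_fst 2 _ _)).prodMk
      ((extendL2 h hV).continuous.comp (WithLp.continuous_snd 2 _ _)))
  have hmaps : MapsTo E (Subtype.val '' (testSubspace V : Set (H1 V)))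
      (Subtype.val '' (testSubspace U : Set (H1 U))) := by
    rintro _ ⟨z, ⟨φ, hφ, h1, h2⟩, rfl⟩
    have hU : IsTest U φ := ⟨hφ.smooth, hφ.compact, hφ.supp.trans h⟩
    have e1 : (extendL2 h hV (fn z) : Plane → ℝ) =ᵐ[volume.restrict U] φ := by
      have := (extendL2_ae h hV (fn z)).trans (indicator_ae_of_ae_restrict h hV h1)
      rwa [hφ.indicator_eq] at this
    have e2 : (extendL2 h hV (wgrad z) : Plane → Plane) =ᵐ[volume.restrict U] gradient φ := by
      have := (extendL2_ae h hV (wgrad z)).trans (indicator_ae_of_ae_restrict h hV h2)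
      rwa [hφ.indicator_gradient_eq] at this
    have hmem : E z ∈ H1 U := by
      intro ψ hψ
      have := hU.isWeakGradient ψ hψ
      rw [integral_congr_ae (g := fun x => φ x • gradient ψ x), this, neg_inj]
      · refine integral_congr_ae ?_
        filter_upwards [e2] with x hx
        rw [← hx]
        rfl
      · filter_upwards [e1] with x hx
        rw [← hx]
        rfl
    exact ⟨⟨E z, hmem⟩, ⟨φ, hU, e1, e2⟩, rfl⟩
  have hcl : E w ∈ closure (Subtype.val '' (testSubspace U : Set (H1 U))) :=
    map_mem_closure hE ((mem_H10_iff w).1 hw) hmaps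
  have hmem : E w ∈ H1 U := closure_minimal (by rintro _ ⟨z, -, rfl⟩; exact z.2) (isClosed_H1 U) hcl
  exact ⟨⟨E w, hmem⟩, (mem_H10_iff _).2 hcl, rfl, rfl⟩

/-! ### Polygonal partitions -/

theorem volume_segment (a b : Plane) : volume (segment ℝ a b) = 0 := by
  refine measure_mono_null ?_ (Measure.addHaar_affineSubspace volume (line[ℝ, a, b]) ?_)
  · rw [← affineSegment_eq_segment]
    exact affineSegment_subset_affineSpan ℝ a b
  · intro h
    -- A line filling the plane would have a direction of dimension two.
    have h1 := (collinear_iff_finrank_le_one (k := ℝ)).1 (collinear_pair ℝ a b)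
    rw [← direction_affineSpan, h, AffineSubspace.direction_top, finrank_top,
      finrank_euclideanSpace_fin] at h1
    norm_num at h1

theorem IsPolygonal.volume_frontier {U : Set Plane} (hU : IsPolygonal U) :
    volume (frontier U) = 0 := by
  obtain ⟨S, hS⟩ := hU.frontier_subset
  exact measure_mono_null hS
    ((measure_biUnion_null_iff S.countable_toSet).2 fun s _ => volume_segment _ _)

namespace PolygonalPartition

variable {Ω : Set Plane} {n : ℕ} (D : PolygonalPartition Ω n)

theorem measurableSet_part (i : Fin n) : MeasurableSet (D.part i) :=
  (D.polygonal i).isOpen.measurableSet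

/-- A point of `Ω` outside every `Ω_i` still lies in some closure of `Ω_i`, hence on a frontier, and
the frontiers are null. -/
theorem iUnion_ae_eq : (⋃ i, D.part i : Set Plane) =ᵐ[volume] Ω := by
  rw [ae_eq_set]
  constructor
  · rw [sdiff_eq_empty.2 (iUnion_subset D.subset), measure_empty]
  · refine measure_mono_null (t := ⋃ i, frontier (D.part i)) ?_
      (measure_iUnion_null fun i => (D.polygonal i).volume_frontier)
    rintro x ⟨hx, hx'⟩
    have hx2 := D.cover ▸ subset_closure hx
    obtain ⟨i, hi⟩ := mem_iUnion.1 hx2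
    refine mem_iUnion.2 ⟨i, hi, fun hxi => hx' (mem_iUnion.2 ⟨i, interior_subset hxi⟩)⟩

theorem ae_restrict {P : Plane → Prop} (h : ∀ i, ∀ᵐ x ∂volume.restrict (D.part i), P x) :
    ∀ᵐ x ∂volume.restrict Ω, P x := by
  rw [← Measure.restrict_congr_set D.iUnion_ae_eq, ae_restrict_iUnion_iff]
  exact h

theorem isBounded (D : PolygonalPartition Ω n) : Bornology.IsBounded Ω := by
  refine Bornology.IsBounded.subset ?_ subset_closure
  rw [D.cover, Bornology.isBounded_iUnion]
  exact fun i => (D.polygonal i).isBounded.closure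

theorem pairing_eq_sum {F : Type} [NormedAddCommGroup F] [InnerProductSpace ℝ F]
    (u v : L2 Ω F) : pairing Ω u v = ∑ i, pairing (D.part i) u v := by
  unfold pairing
  rw [← setIntegral_congr_set D.iUnion_ae_eq, integral_iUnion_fintype D.measurableSet_part
    D.disjoint]
  exact fun i => (L2.integrable_inner (𝕜 := ℝ) u v).mono_measure
    (Measure.restrict_mono (D.subset i) le_rfl)

theorem L2_ext {F : Type} [NormedAddCommGroup F] [NormedSpace ℝ F] {u v : L2 Ω F}
    (h : ∀ i, restrictL2 (D.subset i) F u = restrictL2 (D.subset i) F v) : u = v := by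
  refine Lp.ext (D.ae_restrict fun i => ?_)
  filter_upwards [restrictL2_ae (D.subset i) u, restrictL2_ae (D.subset i) v] with x h1 h2
  rw [← h1, ← h2, h i]

theorem H1_ext {u v : H1 Ω}
    (h : ∀ i, restrictH1 (D.subset i) u = restrictH1 (D.subset i) v) : u = v :=
  Mortar.H1_ext (D.L2_ext fun i => congrArg fn (h i)) (D.L2_ext fun i => congrArg wgrad (h i))

/-- Functions in the spaces `H¹₀(Ω_i)` glue to a function in `H¹₀(Ω)`. -/
theorem exists_glue (w : ∀ i, H1 (D.part i)) (hw : ∀ i, w i ∈ H10 (D.part i)) :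
    ∃ W ∈ H10 Ω, ∀ i, restrictH1 (D.subset i) W = w i := by
  choose W hW h1 h2 using fun i =>
    exists_extension_mem_H10 (D.subset i) (D.measurableSet_part i) (hw i)
  refine ⟨∑ i, W i, sum_mem fun i _ => hW i, fun i => ?_⟩
  -- By disjointness, only the `i`-th extension is nonzero on `Ω_i`.
  rw [map_sum, Finset.sum_eq_single i]
  · refine Mortar.H1_ext ?_ ?_
    · change restrictL2 (D.subset i) ℝ (fn (W i)) = _
      rw [h1, restrictL2_extendL2]
    · change restrictL2 (D.subset i) Plane (wgrad (W i)) = _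
      rw [h2, restrictL2_extendL2]
  · intro j _ hj
    refine Mortar.H1_ext ?_ ?_
    · change restrictL2 (D.subset i) ℝ (fn (W j)) = 0
      rw [h1, restrictL2_extendL2_of_disjoint _ _ _ (D.measurableSet_part i) (D.disjoint hj)]
    · change restrictL2 (D.subset i) Plane (wgrad (W j)) = 0
      rw [h2, restrictL2_extendL2_of_disjoint _ _ _ (D.measurableSet_part i) (D.disjoint hj)]
  · simp

/-- Gluing the restrictions produces an element of `H¹₀(Ω)` that agrees with `z` on every piece,
hence almost everywhere. -/
theorem mem_H10_of_restrict {z : H1 Ω}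
    (h : ∀ i, restrictH1 (D.subset i) z ∈ H10 (D.part i)) : z ∈ H10 Ω := by
  obtain ⟨W, hW, hr⟩ := D.exists_glue _ h
  rwa [← D.H1_ext hr]

/-- Every `w ∈ H¹(Ω)` is the sum of an element of `H^γ` and of a function in `H¹₀(Ω)` whose
restriction to each `Ω_i` is in `H¹₀(Ω_i)`. -/
theorem exists_decomposition (w : H1 Ω) :
    ∃ μ ∈ Hgamma D, ∃ W ∈ H10 Ω, (∀ i, restrictH1 (D.subset i) W ∈ H10 (D.part i)) ∧
      w = μ + W := by
  obtain ⟨W, hW, hr⟩ := D.exists_glue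
    (fun i => (H10 (D.part i)).starProjection (restrictH1 (D.subset i) w))
    (fun i => Submodule.starProjection_apply_mem _ _)
  -- On each `Ω_i` the residual `w - W` is the part of `w` orthogonal to `H¹₀(Ω_i)`, which is the
  -- defining property of `H^γ`.
  refine ⟨w - W, fun i v hv => ?_, W, hW, fun i => ?_, (sub_add_cancel _ _).symm⟩
  · rw [map_sub, hr i]
    exact Submodule.starProjection_inner_eq_zero _ v hv
  · rw [hr i]
    exact Submodule.starProjection_apply_mem _ _

end PolygonalPartition

/-! ### The flux -/

section Flux

variable {Ω : Set Plane} {K : Plane → Matrix (Fin 2) (Fin 2) ℝ}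

theorem IsCoefficient.memLp_flux (hK : IsCoefficient Ω K) (p : H1 Ω) :
    MemLp (flux K p) 2 (volume.restrict Ω) := by
  refine MemLp.of_eval_piLp fun i => ?_
  have h : ∀ j, MemLp (fun x => K x i j * wgrad p x j) 2 (volume.restrict Ω) := fun j =>
    MemLp.mul' ((Lp.memLp (wgrad p)).eval_piLp j) (hK.bounded i j)
  refine ((h 0).add (h 1)).ae_eq (.of_forall fun x => ?_)
  fin_cases i <;> simp [flux, Matrix.toLpLin_apply]

theorem flux_add (K : Plane → Matrix (Fin 2) (Fin 2) ℝ) (p q : H1 Ω) :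
    flux K (p + q) =ᵐ[volume.restrict Ω] flux K p + flux K q := by
  filter_upwards [Lp.coeFn_add (wgrad p) (wgrad q)] with x hx
  change (K x).toEuclideanLin ((wgrad p + wgrad q : L2 Ω Plane) x) = _
  rw [hx, Pi.add_apply, map_add]
  rfl

theorem flux_sub (K : Plane → Matrix (Fin 2) (Fin 2) ℝ) (p q : H1 Ω) :
    flux K (p - q) =ᵐ[volume.restrict Ω] flux K p - flux K q := by
  filter_upwards [Lp.coeFn_sub (wgrad p) (wgrad q)] with x hx
  change (K x).toEuclideanLin ((wgrad p - wgrad q : L2 Ω Plane) x) = _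
  rw [hx, Pi.sub_apply, map_sub]
  rfl

/-- Stated for any `V ⊆ Ω`, so that the law can be read off on the pieces and reassembled on `Ω` as
a pointwise identity. -/
theorem IsCoefficient.ae_eq_flux_iff (hK : IsCoefficient Ω K) {V : Set Plane} (h : V ⊆ Ω)
    (u : L2 Ω Plane) (p : H1 Ω) :
    (∀ v : L2 V Plane, pairing V u v - pairing V (flux K p) v = 0) ↔
      u =ᵐ[volume.restrict V] flux K p :=
  ae_eq_iff_pairing ((Lp.memLp u).mono_measure (Measure.restrict_mono h le_rfl))
    ((hK.memLp_flux p).mono_measure (Measure.restrict_mono h le_rfl))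

/-- The energy `(K∇p, ∇p)` vanishes only for `∇p = 0`. -/
theorem IsCoefficient.wgrad_eq_zero (hK : IsCoefficient Ω K) {p : H1 Ω}
    (h : pairing Ω (flux K p) (wgrad p) = 0) : wgrad p = 0 := by
  have hi : Integrable (fun x => inner ℝ (flux K p x) (wgrad p x)) (volume.restrict Ω) :=
    (L2.integrable_inner (𝕜 := ℝ) ((hK.memLp_flux p).toLp _) (wgrad p)).congr <| by
      filter_upwards [(hK.memLp_flux p).coeFn_toLp] with x hx
      rw [hx]
  have hn : 0 ≤ᵐ[volume.restrict Ω] fun x => inner ℝ (flux K p x) (wgrad p x) := by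
    filter_upwards [hK.posDef] with x hx
    by_cases h0 : wgrad p x = 0
    · simp [h0]
    · exact (hx _ h0).le
  have h0 := (integral_eq_zero_iff_of_nonneg_ae hn hi).1 h
  refine Lp.ext ?_
  filter_upwards [h0, hK.posDef, Lp.coeFn_zero Plane 2 (volume.restrict Ω)] with x h1 h2 h3
  rw [h3]
  by_contra hne
  exact (h2 _ hne).ne' h1

end Flux

/-! ### Uniqueness -/

theorem IsTest.eLpNorm_restrict {U : Set Plane} {φ : Plane → ℝ} (hφ : IsTest U φ)
    (hU : MeasurableSet U) (p : ENNReal) :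
    eLpNorm φ p (volume.restrict U) = eLpNorm φ p volume := by
  rw [← eLpNorm_indicator_eq_eLpNorm_restrict hU, hφ.indicator_eq]

theorem IsTest.eLpNorm_gradient_restrict {U : Set Plane} {φ : Plane → ℝ} (hφ : IsTest U φ)
    (hU : MeasurableSet U) (p : ENNReal) :
    eLpNorm (gradient φ) p (volume.restrict U) = eLpNorm (fderiv ℝ φ) p volume := by
  rw [← eLpNorm_indicator_eq_eLpNorm_restrict hU, hφ.indicator_gradient_eq]
  exact eLpNorm_congr_norm_ae (.of_forall fun x =>
    (InnerProductSpace.toDual ℝ Plane).symm.norm_map _)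

/-- The Poincaré inequality. -/
theorem exists_norm_fn_le {U : Set Plane} (hU : MeasurableSet U) (hb : volume U ≠ ⊤) :
    ∃ C : ℝ, ∀ z ∈ H10 U, ‖fn z‖ ≤ C * ‖wgrad z‖ := by
  -- The constant of the Sobolev embedding `W^{1,1} → L²` in dimension two, times the Hölder factor
  -- `|U|^{1/2}` that bounds the `L¹` norm of the gradient by its `L²` norm.
  set c : ENNReal := eLpNormLESNormFDerivOneConst (volume : Measure Plane) (2 : NNReal) *
    volume U ^ (1 / (1 : ENNReal).toReal - 1 / (2 : ENNReal).toReal) with hc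
  have hctop : c ≠ ⊤ := ENNReal.mul_ne_top ENNReal.coe_ne_top
    (ENNReal.rpow_ne_top_of_nonneg (by norm_num) hb)
  refine ⟨c.toReal, fun z hz => ?_⟩
  -- Both norms are continuous on `H¹(U)`, so the inequality need only be checked on test functions.
  refine closure_minimal (t := {z : H1 U | ‖fn z‖ ≤ c.toReal * ‖wgrad z‖}) ?_
    (isClosed_le (continuous_fn U).norm (continuous_const.mul (continuous_wgrad U).norm)) hz
  rintro z ⟨φ, hφ, h1, h2⟩
  have key : eLpNorm (fn z) 2 (volume.restrict U) ≤
      c * eLpNorm (wgrad z) 2 (volume.restrict U) := by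
    rw [eLpNorm_congr_ae h1, eLpNorm_congr_ae h2, hφ.eLpNorm_restrict hU]
    have s1 := eLpNorm_le_eLpNorm_fderiv_one (volume : Measure Plane)
      (hφ.smooth.of_le (by simp)) hφ.compact (p := 2)
      (by rw [finrank_euclideanSpace_fin]; exact_mod_cast NNReal.HolderConjugate.two_two)
    rw [← hφ.eLpNorm_gradient_restrict hU] at s1
    have s2 := eLpNorm_le_eLpNorm_mul_rpow_measure_univ (p := 1) (q := 2)
      (μ := volume.restrict U) (by norm_num) hφ.continuous_gradient.aestronglyMeasurable
    rw [Measure.restrict_apply_univ] at s2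
    calc eLpNorm φ 2 volume ≤ _ := s1
      _ ≤ _ := mul_le_mul_right s2 _
      _ = _ := by rw [hc]; ring
  change ‖fn z‖ ≤ c.toReal * ‖wgrad z‖
  rw [Lp.norm_def, Lp.norm_def, ← ENNReal.toReal_mul]
  exact ENNReal.toReal_mono (ENNReal.mul_ne_top hctop (Lp.eLpNorm_ne_top _)) key

theorem eq_zero_of_wgrad_eq_zero {U : Set Plane} (hU : MeasurableSet U) (hb : volume U ≠ ⊤)
    {z : H1 U} (hz : z ∈ H10 U) (h : wgrad z = 0) : z = 0 := by
  obtain ⟨C, hC⟩ := exists_norm_fn_le hU hb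
  have h1 := hC z hz
  rw [h, norm_zero, mul_zero] at h1
  exact H1_ext (norm_le_zero_iff.1 h1) h

/-- The difference `p - p'` is an admissible test function. Inserted into both balance equations, it
makes the source cancel and leaves zero energy. -/
theorem IsGlobalSolution.unique {Ω : Set Plane} (hΩ : MeasurableSet Ω) (hb : volume Ω ≠ ⊤)
    {K : Plane → Matrix (Fin 2) (Fin 2) ℝ} (hK : IsCoefficient Ω K) {f : L2 Ω ℝ}
    {g : TraceSpace Ω} {u u' : L2 Ω Plane} {p p' : H1 Ω} (h : IsGlobalSolution K f g u p)
    (h' : IsGlobalSolution K f g u' p') : u = u' ∧ p = p' := by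
  have hd : p - p' ∈ H10 Ω :=
    (Submodule.Quotient.eq _).1 (h.boundary.trans h'.boundary.symm)
  have e := (hK.ae_eq_flux_iff Subset.rfl u p).1 h.constitutive
  have e' := (hK.ae_eq_flux_iff Subset.rfl u' p').1 h'.constitutive
  have h0 : pairing Ω (flux K (p - p')) (wgrad (p - p')) = 0 := by
    have hu : (↑(u - u') : Plane → Plane) =ᵐ[volume.restrict Ω] flux K (p - p') :=
      (Lp.coeFn_sub u u').trans ((e.sub e').trans (flux_sub K p p').symm)
    rw [← pairing_congr hu ae_eq_rfl, pairing_eq_inner, inner_sub_left, ← pairing_eq_inner,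
      ← pairing_eq_inner, h.balance _ hd, h'.balance _ hd, sub_self]
  have hp : p = p' :=
    sub_eq_zero.1 (eq_zero_of_wgrad_eq_zero hΩ hb hd (hK.wgrad_eq_zero h0))
  subst hp
  exact ⟨Lp.ext (e.trans e'.symm), rfl⟩

/-! ### The interface problem -/

section Interface

variable {Ω : Set Plane} {n : ℕ} {D : PolygonalPartition Ω n}
  {K : Plane → Matrix (Fin 2) (Fin 2) ℝ} {f : L2 Ω ℝ} {g : TraceSpace Ω}

theorem pairing_add_left {V : Set Plane} (h : V ⊆ Ω) (u u' v : L2 Ω Plane) :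
    pairing V (u + u' : L2 Ω Plane) v = pairing V u v + pairing V u' v := by
  simp only [pairing_restrict h, map_add, inner_add_left]

theorem pairing_restrict_right {F : Type} [NormedAddCommGroup F] [InnerProductSpace ℝ F]
    {V : Set Plane} (h : V ⊆ Ω) (u v : L2 Ω F) :
    pairing V u (restrictL2 h F v) = pairing V u v :=
  pairing_congr ae_eq_rfl (restrictL2_ae h v)

theorem isGlobalSolution_of_interface (hK : IsCoefficient Ω K) {uS uBar : L2 Ω Plane}
    {pS pBar lam : H1 Ω} (hBar : IsBarSolution D K f uBar pBar) (hlam : trace lam = g)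
    (hStar : IsStarSolution D K lam uS pS)
    (hsol : ∀ μ ∈ HgammaBC D 0, ∑ i, pairing (D.part i) uS (wgrad μ) =
      loadFunctional D f uBar μ) :
    IsGlobalSolution K f g (uS + uBar) (pS + pBar) where
  boundary := by
    -- The local Dirichlet data fix `pS` modulo `H¹₀(Ω_i)` on each piece, hence `pS` and `lam` have
    -- the same boundary value on `∂Ω`.
    have h1 : pS - lam ∈ H10 Ω := D.mem_H10_of_restrict fun i => by
      rw [map_sub]
      exact (Submodule.Quotient.eq _).1 (hStar.boundary i)
    rw [← hlam]
    refine (Submodule.Quotient.eq _).2 ?_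
    rw [add_sub_right_comm]
    exact add_mem h1 hBar.mem_H10
  constitutive := by
    refine (hK.ae_eq_flux_iff Subset.rfl _ _).2 ?_
    have e1 : uS =ᵐ[volume.restrict Ω] flux K pS := D.ae_restrict fun i =>
      (hK.ae_eq_flux_iff (D.subset i) uS pS).1 (hStar.constitutive i)
    have e2 : uBar =ᵐ[volume.restrict Ω] flux K pBar := D.ae_restrict fun i =>
      (hK.ae_eq_flux_iff (D.subset i) uBar pBar).1 (hBar.constitutive i)
    exact (Lp.coeFn_add uS uBar).trans ((e1.add e2).trans (flux_add K pS pBar).symm)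
  balance := by
    intro w hw
    -- `W` is tested piece by piece in the local problems, `μ` in the interface equation.
    obtain ⟨μ, hμ, W, hW, hWi, rfl⟩ := D.exists_decomposition w
    have hμ0 : trace μ = 0 := (Submodule.Quotient.mk_eq_zero _).2 <| by
      have := sub_mem hw hW
      rwa [add_sub_cancel_right] at this
    have hs := hsol μ ⟨hμ, hμ0⟩
    have h1 : ∀ i, pairing (D.part i) uS (wgrad W) = 0 := fun i => by
      rw [← pairing_restrict_right (D.subset i)]
      exact hStar.balance i _ (hWi i)
    have h2 : ∀ i, pairing (D.part i) uBar (wgrad W) = pairing (D.part i) f (fn W) := fun i => by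
      rw [← pairing_restrict_right (D.subset i), ← pairing_restrict_right (D.subset i)]
      exact hBar.balance i _ (hWi i)
    have h3 : pairing Ω (uS + uBar : L2 Ω Plane) (wgrad W) = pairing Ω f (fn W) := by
      rw [D.pairing_eq_sum, D.pairing_eq_sum]
      refine Finset.sum_congr rfl fun i _ => ?_
      rw [pairing_add_left (D.subset i), h1, h2, zero_add]
    have h4 : pairing Ω (uS + uBar : L2 Ω Plane) (wgrad μ) = pairing Ω f (fn μ) := by
      -- The `ū` terms in `L(μ)` cancel against the contribution of `uBar` to the total flux,
      -- leaving `(f, μ)`.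
      rw [pairing_add_left Subset.rfl, D.pairing_eq_sum uS, hs, loadFunctional,
        ← D.pairing_eq_sum, sub_add_cancel]
    have h5 : pairing Ω (uS + uBar : L2 Ω Plane) (wgrad (μ + W)) =
        pairing Ω (uS + uBar : L2 Ω Plane) (wgrad μ) +
          pairing Ω (uS + uBar : L2 Ω Plane) (wgrad W) :=
      inner_add_right (𝕜 := ℝ) (uS + uBar) (wgrad μ) (wgrad W)
    have h6 : pairing Ω f (fn (μ + W)) = pairing Ω f (fn μ) + pairing Ω f (fn W) :=
      inner_add_right (𝕜 := ℝ) f (fn μ) (fn W)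
    rw [h5, h6, h3, h4]

end Interface

end Mortar

/-! ### The interface solution is the unique global solution -/

theorem mainTheorem5 {Ω : Set Mortar.Plane} {n : ℕ} (hΩ : IsOpen Ω)
    (D : Mortar.PolygonalPartition Ω n)
    (K : Mortar.Plane → Matrix (Fin 2) (Fin 2) ℝ) (hK : Mortar.IsCoefficient Ω K)
    (f : Mortar.L2 Ω ℝ) (g : Mortar.TraceSpace Ω)
    (uStar : Mortar.H1 Ω → Mortar.L2 Ω Mortar.Plane) (pStar : Mortar.H1 Ω → Mortar.H1 Ω)
    (uBar : Mortar.L2 Ω Mortar.Plane) (pBar : Mortar.H1 Ω)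
    (hBar : Mortar.IsBarSolution D K f uBar pBar)
    (lam : Mortar.H1 Ω) (hlam : lam ∈ Mortar.HgammaBC D g)
    (hStar : Mortar.IsStarSolution D K lam (uStar lam) (pStar lam))
    (hsol : ∀ μ ∈ Mortar.HgammaBC D 0,
      Mortar.interfaceForm D uStar lam μ = Mortar.loadFunctional D f uBar μ) :
    Mortar.IsGlobalSolution K f g (uStar lam + uBar) (pStar lam + pBar) ∧
      ∀ (u : Mortar.L2 Ω Mortar.Plane) (p : Mortar.H1 Ω), Mortar.IsGlobalSolution K f g u p →
        u = uStar lam + uBar ∧ p = pStar lam + pBar := by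
  have h := Mortar.isGlobalSolution_of_interface hK hBar hlam.2 hStar hsol
  exact ⟨h, fun u p hup =>
    hup.unique hΩ.measurableSet D.isBounded.measure_lt_top.ne hK h⟩
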